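/- Let $p$ be a prime and let $k,n\ge 2$. For $m\ge 2$ let $\mathrm{UT}_m(\mathbb F_p)$ be the group of upper unitriangular $m\times m$ matrices over $\mathbb F_p$. For a finite group $G$ let $$B_0(G)=\bigcap_{A}\ker\bigl(\mathrm{res}^G_A: H^2(G,\mathbb Q/\mathbb Z)\to H^2(A,\mathbb Q/\mathbb Z)\bigr)$$ be its Bogomolov multiplier, where $\mathbb Q/\mathbb Z$ carries the trivial action and $A$ runs over the bicyclic subgroups of $G$, i.e. those that are cyclic or a direct product of two cyclic groups. Let $G_1\cong \mathrm{UT}_k(\mathbb F_p)$ and $G_2\cong\mathrm{UT}_n(\mathbb F_p)$, let $K_1\le Z(G_1)$ and $K_2\le Z(G_2)$ be central subgroups, and let $\theta:K_1\to K_2$ be an isomorphism. Let $G$ be the corresponding central product of $G_1$ and $G_2$, that is, $G=(G_1\times G_2)/N$ with $$N=\{(a,b): a\in K_1,\ b\in K_2,\ \theta(a)=b^{-1}\}.$$ Then $B_0(G)=0$. In particular this holds when the full centres $Z(G_1)\cong Z(G_2)\cong\mathbb F_p$ are amalgamated. -/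

import Mathlib

/-- The group `UT_n(R)` of upper unitriangular `n × n` matrices over a commutative ring `R`,
as a subgroup of `GL_n(R)`. -/
def unitriangularGroup (n : ℕ) (R : Type) [CommRing R] : Subgroup (GL (Fin n) R) where
  carrier := {g | (∀ i, g i i = 1) ∧ ∀ i j, j < i → g i j = 0}
  one_mem' := by
    refine ⟨fun i => ?_, fun i j hij => ?_⟩
    · simp
    · simpa using Matrix.one_apply_ne (α := R) hij.ne'
  mul_mem' := by
    rintro a b ⟨ha1, ha0⟩ ⟨hb1, hb0⟩
    refine ⟨fun i => ?_, fun i j hij => ?_⟩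
    · rw [Matrix.GeneralLinearGroup.coe_mul, Matrix.mul_apply, Finset.sum_eq_single i]
      · rw [ha1, hb1, one_mul]
      · intro k _ hk
        rcases lt_or_gt_of_ne hk with h | h
        · rw [ha0 i k h, zero_mul]
        · rw [hb0 k i h, mul_zero]
      · simp
    · rw [Matrix.GeneralLinearGroup.coe_mul, Matrix.mul_apply]
      refine Finset.sum_eq_zero fun k _ => ?_
      rcases lt_or_ge k i with h | h
      · rw [ha0 i k h, zero_mul]
      · rw [hb0 k j (hij.trans_le h), mul_zero]
  inv_mem' := by
    rintro a ⟨ha1, ha0⟩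
    have hT : Matrix.BlockTriangular (a⁻¹ : GL (Fin n) R).1 id := by
      have h := Matrix.blockTriangular_inv_of_blockTriangular (M := a.1) (b := id)
        (fun i j hij => ha0 i j hij)
      rwa [← Matrix.coe_units_inv] at h
    refine ⟨fun i => ?_, fun i j hij => hT hij⟩
    have h : (a.1 * (a⁻¹ : GL (Fin n) R).1) i i = 1 := by
      rw [← Units.val_mul, mul_inv_cancel, Units.val_one, Matrix.one_apply_eq]
    rw [Matrix.mul_apply, Finset.sum_eq_single i] at h
    · rwa [ha1, one_mul] at h
    · intro k _ hk
      rcases lt_or_gt_of_ne hk with h | h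
      · rw [ha0 i k h, zero_mul]
      · rw [show (a⁻¹ : GL (Fin n) R).1 k i = 0 from hT h, mul_zero]
    · simp

section CentralProduct

variable {G₁ G₂ : Type} [Group G₁] [Group G₂] {K₁ : Subgroup G₁} {K₂ : Subgroup G₂}

/-- The subgroup `N = {ab : a ∈ K₁, b ∈ K₂, θ(a) = b⁻¹}` of `E = G₁ × G₂`, for an isomorphism
`θ : K₁ → K₂` between central subgroups `K₁ ≤ Z(G₁)` and `K₂ ≤ Z(G₂)`. -/
def amalgam (_hK₁ : K₁ ≤ Subgroup.center G₁) (hK₂ : K₂ ≤ Subgroup.center G₂) (θ : K₁ ≃* K₂) :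
    Subgroup (G₁ × G₂) where
  carrier := {x | ∃ (a : K₁) (b : K₂), θ a = b⁻¹ ∧ x = ((a : G₁), (b : G₂))}
  one_mem' := ⟨1, 1, by simp, rfl⟩
  mul_mem' := by
    rintro _ _ ⟨a, b, hab, rfl⟩ ⟨a', b', hab', rfl⟩
    refine ⟨a * a', b * b', ?_, rfl⟩
    rw [map_mul, hab, hab', ← mul_inv_rev]
    congr 1
    exact Subtype.ext ((Subgroup.mem_center_iff.mp (hK₂ b.2)) b')
  inv_mem' := by
    rintro _ ⟨a, b, hab, rfl⟩
    exact ⟨a⁻¹, b⁻¹, by rw [map_inv, hab], rfl⟩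

instance amalgam_normal (hK₁ : K₁ ≤ Subgroup.center G₁) (hK₂ : K₂ ≤ Subgroup.center G₂)
    (θ : K₁ ≃* K₂) : (amalgam hK₁ hK₂ θ).Normal where
  conj_mem := by
    rintro _ ⟨a, b, hab, rfl⟩ ⟨g, h⟩
    refine ⟨a, b, hab, Prod.ext ?_ ?_⟩
    · change g * a * g⁻¹ = a
      rw [Subgroup.mem_center_iff.mp (hK₁ a.2) g, mul_inv_cancel_right]
    · change h * b * h⁻¹ = b
      rw [Subgroup.mem_center_iff.mp (hK₂ b.2) h, mul_inv_cancel_right]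

/-- The central product `(G₁ × G₂) / N` of `G₁` and `G₂` with respect to the isomorphism
`θ : K₁ → K₂` of central subgroups. -/
abbrev CentralProduct (hK₁ : K₁ ≤ Subgroup.center G₁) (hK₂ : K₂ ≤ Subgroup.center G₂)
    (θ : K₁ ≃* K₂) : Type :=
  (G₁ × G₂) ⧸ amalgam hK₁ hK₂ θ

end CentralProduct

section BogomolovMultiplier

/-- A group is bicyclic if it is cyclic or a direct product of two cyclic groups. -/
def IsBicyclic (A : Type) [Group A] : Prop :=
  IsCyclic A ∨
    ∃ C D : Subgroup A, IsCyclic C ∧ IsCyclic D ∧ Nonempty (A ≃* C × D)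

/-- `ℚ/ℤ` as a `ℤ`-linear representation of `G` with trivial action. -/
noncomputable abbrev trivialQModZ (G : Type) [Group G] : Rep.{0} ℤ G :=
  Rep.trivial ℤ G (AddCircle (1 : ℚ))

/-- The restriction map `res : H²(G, ℚ/ℤ) → H²(A, ℚ/ℤ)` to a subgroup `A ≤ G`. -/
noncomputable def resH2 {G : Type} [Group G] (A : Subgroup G) :
    groupCohomology.H2 (trivialQModZ G) →ₗ[ℤ] groupCohomology.H2 (trivialQModZ A) :=
  (groupCohomology.map (A := trivialQModZ G) (B := trivialQModZ A) A.subtype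
    (CategoryTheory.CategoryStruct.id (trivialQModZ A)) 2).hom

/-- The Bogomolov multiplier `B₀(G)` of a (finite) group `G`: the classes in `H²(G, ℚ/ℤ)` whose
restriction to every bicyclic subgroup of `G` vanishes. -/
noncomputable def bogomolovMultiplier (G : Type) [Group G] :
    Submodule ℤ (groupCohomology.H2 (trivialQModZ G)) :=
  ⨅ (A : Subgroup G) (_ : IsBicyclic A), LinearMap.ker (resH2 A)

end BogomolovMultiplier

/-! A class in `H²(G, ℚ/ℤ)` defines a central extension `π : E → G` with divisible kernel. If the
class lies in `B₀(G)`, restricting it to the subgroup generated by a commuting pair shows that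
elements of `E` commute as soon as their images do. So it suffices to split every extension with
these two properties (`bogomolovMultiplier_eq_bot_of_splits`); its kernel is automatically central.

Homomorphisms from `UT_n` lift along such a `π` (`unitriangularGroup.exists_lift`), by induction on
`n`. `UT_{m+1}` is the semidirect product of the first rows `𝔽_p^m` and the block `UT_m`, and the
row `e_{i+1}` is the commutator of `e_i` with a simple matrix. Divisibility gives a lift of `e_0` of
exponent `p`, commutators give the other rows, and the remaining relations reduce to commutations,
which hold in `E` because they hold in `G`.

Lifts of the two factors commute with each other, hence define `G₁ × G₂ → E`; the issue is whether
`N` dies. If all elements of `K₁` and `K₂` are commutators, each element of `N` is the commutator of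
a pair whose images in `G` commute, so it maps to `1` (`CentralProduct.exists_section`). This covers
sizes at least `3`. In `UT_2`, of prime order, the amalgamated subgroup is trivial or everything; in
the second case that factor is absorbed by the other one and takes its lift from there. -/

namespace unitriangularGroup

/-! ### Unitriangular matrices: row-block decomposition and generators -/

variable {R : Type} [CommRing R] {n : ℕ}

/-- The element of the unitriangular group given by a unitriangular matrix. -/
noncomputable def ofMatrix (M : Matrix (Fin n) (Fin n) R) (h1 : ∀ i, M i i = 1)
    (h0 : ∀ i j, j < i → M i j = 0) : unitriangularGroup n R :=
  ⟨Matrix.GeneralLinearGroup.mk'' M (by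
    rw [Matrix.det_of_isUpperTriangular (fun i j h => h0 i j h)]
    simp [h1]), h1, h0⟩

/-- The matrix of an element of the unitriangular group. -/
def toMatrix (g : unitriangularGroup n R) : Matrix (Fin n) (Fin n) R := g.1.1

theorem toMatrix_injective : Function.Injective (toMatrix : unitriangularGroup n R → _) :=
  fun _ _ h => Subtype.ext (Units.ext h)

@[simp]
theorem toMatrix_mul (g h : unitriangularGroup n R) :
    toMatrix (g * h) = toMatrix g * toMatrix h := rfl

@[simp]
theorem toMatrix_one : toMatrix (1 : unitriangularGroup n R) = 1 := rfl

theorem toMatrix_diag (g : unitriangularGroup n R) (i : Fin n) : toMatrix g i i = 1 := g.2.1 i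

theorem toMatrix_lower (g : unitriangularGroup n R) {i j : Fin n} (h : j < i) :
    toMatrix g i j = 0 := g.2.2 i j h

/-- The unitriangular matrix with first row `(1, w)` and lower right block `h`. -/
noncomputable def bordered (h : unitriangularGroup n R) (w : Fin n → R) :
    unitriangularGroup (n + 1) R :=
  ofMatrix (Matrix.of (Fin.cons (Fin.cons 1 w) fun i => Fin.cons 0 (toMatrix h i)))
    (fun i => by
      cases i using Fin.cases with
      | zero => simp
      | succ i => simp [toMatrix_diag])
    (fun i j hij => by
      cases i using Fin.cases with
      | zero => simp at hij
      | succ i =>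
        cases j using Fin.cases with
        | zero => simp
        | succ j => simp [toMatrix_lower h (Fin.succ_lt_succ_iff.mp hij)])

section bordered

variable (h : unitriangularGroup n R) (w : Fin n → R)

@[simp] theorem bordered_zero_zero : toMatrix (bordered h w) 0 0 = 1 := rfl
@[simp] theorem bordered_zero_succ (j : Fin n) : toMatrix (bordered h w) 0 j.succ = w j := rfl
@[simp] theorem bordered_succ_zero (i : Fin n) : toMatrix (bordered h w) i.succ 0 = 0 := rfl
@[simp] theorem bordered_succ_succ (i j : Fin n) :
    toMatrix (bordered h w) i.succ j.succ = toMatrix h i j := rfl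

end bordered

theorem ext_succ {g g' : unitriangularGroup (n + 1) R}
    (h0 : ∀ j : Fin n, toMatrix g 0 j.succ = toMatrix g' 0 j.succ)
    (h : ∀ i j : Fin n, toMatrix g i.succ j.succ = toMatrix g' i.succ j.succ) : g = g' := by
  apply toMatrix_injective
  ext i j
  cases i using Fin.cases with
  | zero =>
    cases j using Fin.cases with
    | zero => rw [toMatrix_diag, toMatrix_diag]
    | succ j => exact h0 j
  | succ i =>
    cases j using Fin.cases with
    | zero => rw [toMatrix_lower _ i.succ_pos, toMatrix_lower _ i.succ_pos]
    | succ j => exact h i j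

theorem bordered_mul (h h' : unitriangularGroup n R) (w w' : Fin n → R) :
    bordered h w * bordered h' w' =
      bordered (h * h') (w' + Matrix.vecMul w (toMatrix h')) := by
  apply ext_succ
  · intro j
    simp [Matrix.mul_apply, Fin.sum_univ_succ, Matrix.vecMul, dotProduct]
  · intro i j
    simp [Matrix.mul_apply, Fin.sum_univ_succ]

theorem bordered_one_zero : bordered (1 : unitriangularGroup n R) 0 = 1 := by
  apply ext_succ
  · intro j
    simp [(Fin.succ_ne_zero j).symm]
  · intro i j
    simp [Matrix.one_apply]

/-- The lower right block of a unitriangular matrix. -/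
noncomputable def block (g : unitriangularGroup (n + 1) R) : unitriangularGroup n R :=
  ofMatrix (fun i j => toMatrix g i.succ j.succ) (fun i => toMatrix_diag g i.succ)
    (fun _ _ hij => toMatrix_lower g (Fin.succ_lt_succ_iff.mpr hij))

/-- The first row of a unitriangular matrix, without its diagonal entry. -/
def row (g : unitriangularGroup (n + 1) R) : Fin n → R := fun j => toMatrix g 0 j.succ

theorem bordered_block_row (g : unitriangularGroup (n + 1) R) : bordered (block g) (row g) = g :=
  ext_succ (fun _ => rfl) (fun _ _ => rfl)

theorem block_bordered (h : unitriangularGroup n R) (w : Fin n → R) :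
    block (bordered h w) = h := toMatrix_injective rfl

theorem row_bordered (h : unitriangularGroup n R) (w : Fin n → R) :
    row (bordered h w) = w := rfl

theorem block_mul (g g' : unitriangularGroup (n + 1) R) :
    block (g * g') = block g * block g' := by
  rw [← bordered_block_row g, ← bordered_block_row g', bordered_mul]
  simp only [block_bordered]

theorem row_mul (g g' : unitriangularGroup (n + 1) R) :
    row (g * g') = row g' + Matrix.vecMul (row g) (toMatrix (block g')) := by
  rw [← bordered_block_row g, ← bordered_block_row g', bordered_mul]
  simp only [block_bordered, row_bordered]

/-- The embedding of a unitriangular group as lower right block in the next one. -/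
noncomputable def blockHom : unitriangularGroup n R →* unitriangularGroup (n + 1) R where
  toFun h := bordered h 0
  map_one' := bordered_one_zero
  map_mul' h h' := by rw [bordered_mul, Matrix.zero_vecMul, add_zero]

/-- The embedding of row vectors as first row in a unitriangular group. -/
noncomputable def rowHom : Multiplicative (Fin n → R) →* unitriangularGroup (n + 1) R where
  toFun w := bordered 1 w.toAdd
  map_one' := bordered_one_zero
  map_mul' w w' := by
    rw [bordered_mul, toMatrix_one, Matrix.vecMul_one, one_mul, toAdd_mul,
      add_comm w.toAdd]

theorem blockHom_mul_rowHom (h : unitriangularGroup n R) (w : Multiplicative (Fin n → R)) :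
    blockHom h * rowHom w = bordered h w.toAdd := by
  change bordered h 0 * bordered 1 w.toAdd = _
  rw [bordered_mul, Matrix.zero_vecMul, add_zero, mul_one]

theorem rowHom_mul_blockHom (h : unitriangularGroup n R) (w : Fin n → R) :
    rowHom (.ofAdd w) * blockHom h =
      blockHom h * rowHom (.ofAdd (Matrix.vecMul w (toMatrix h))) := by
  rw [blockHom_mul_rowHom]
  change bordered 1 w * bordered h 0 = _
  rw [bordered_mul, one_mul, zero_add]
  rfl

/-- The elementary unitriangular matrix with entry `1` in position `(i, i + 1)`; it is trivial
if there is no such position. -/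
noncomputable def simple (n : ℕ) (R : Type) [CommRing R] (i : ℕ) : unitriangularGroup n R :=
  ofMatrix (fun a b => if a = b then 1 else if (a : ℕ) = i ∧ (b : ℕ) = i + 1 then 1 else 0)
    (fun a => by simp)
    (fun a b hab => by
      have := Fin.lt_def.mp hab
      rw [if_neg hab.ne', if_neg (by omega)])

theorem toMatrix_simple (i : ℕ) (a b : Fin n) : toMatrix (simple n R i) a b =
    if a = b then 1 else if (a : ℕ) = i ∧ (b : ℕ) = i + 1 then 1 else 0 := rfl

/-- The `i`-th standard row vector, which is zero for `i ≥ n`. -/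
def stdRow (n : ℕ) (R : Type) [CommRing R] (i : ℕ) : Fin n → R :=
  fun a => if (a : ℕ) = i then 1 else 0

theorem stdRow_coe (i : Fin n) : stdRow n R i = Pi.single i 1 := by
  ext a
  simp [stdRow, Pi.single_apply, Fin.ext_iff]

theorem stdRow_of_le {i : ℕ} (h : n ≤ i) : stdRow n R i = 0 := by
  ext a
  simp [stdRow, show (a : ℕ) ≠ i by omega]

/-- In `UT_{n+1}` this makes `e_{i+1}` the commutator of `e_i` with a simple matrix. Indices in `ℕ`
absorb the boundary: for `i = n - 1` the matrix is trivial and `e_n = 0`. -/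
theorem stdRow_vecMul_self (i : ℕ) :
    Matrix.vecMul (stdRow n R i) (toMatrix (simple n R i)) =
      stdRow n R i + stdRow n R (i + 1) := by
  rcases lt_or_ge i n with h | h
  · lift i to Fin n using h
    rw [stdRow_coe, Matrix.single_one_vecMul]
    ext a
    by_cases hia : i = a
    · subst hia
      simp [toMatrix_simple, stdRow]
    · simp [toMatrix_simple, stdRow, hia, Ne.symm hia]
  · rw [stdRow_of_le h, stdRow_of_le (by omega), Matrix.zero_vecMul, add_zero]

theorem stdRow_vecMul_of_ne {i j : ℕ} (hij : j ≠ i) :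
    Matrix.vecMul (stdRow n R j) (toMatrix (simple n R i)) = stdRow n R j := by
  rcases lt_or_ge j n with h | h
  · lift j to Fin n using h
    rw [stdRow_coe, Matrix.single_one_vecMul]
    ext a
    simp [toMatrix_simple, hij, Pi.single_apply, eq_comm]
  · rw [stdRow_of_le h, Matrix.zero_vecMul]

theorem blockHom_simple (i : ℕ) : blockHom (simple n R i) = simple (n + 1) R (i + 1) := by
  apply ext_succ
  · intro j
    simp [blockHom, toMatrix_simple, (Fin.succ_ne_zero j).symm]
  · intro a b
    simp [blockHom, toMatrix_simple]

theorem rowHom_stdRow_zero : rowHom (.ofAdd (stdRow n R 0)) = simple (n + 1) R 0 := by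
  apply ext_succ
  · intro j
    simp [rowHom, toMatrix_simple, stdRow, (Fin.succ_ne_zero j).symm]
  · intro a b
    simp [rowHom, toMatrix_simple, Matrix.one_apply]

/-- Additive subgroups are automatically stable under scalars from `ZMod p`, so a spanning set
suffices. -/
theorem addSubgroup_eq_top_of_stdRow_mem {p : ℕ} (W : AddSubgroup (Fin n → ZMod p))
    (h : ∀ i, stdRow n (ZMod p) i ∈ W) : W = ⊤ := by
  rw [eq_top_iff]
  intro w _
  rw [pi_eq_sum_univ' w]
  refine sum_mem fun i _ => ?_
  rw [← stdRow_coe]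
  exact (AddSubgroup.toZModSubmodule p W).smul_mem _ (h i)

/-- Unitriangular groups over `ZMod p` are generated by the simple elementary matrices. -/
theorem eq_top_of_simple_mem {p : ℕ} (S : Subgroup (unitriangularGroup n (ZMod p)))
    (hS : ∀ i, simple n (ZMod p) i ∈ S) : S = ⊤ := by
  induction n with
  | zero =>
    rw [eq_top_iff]
    intro g _
    rw [show g = 1 from toMatrix_injective (Subsingleton.elim _ _)]
    exact S.one_mem
  | succ m ih =>
    have hblock : ∀ h, blockHom h ∈ S := by
      intro h
      have := ih (S.comap blockHom) fun i => by
        rw [Subgroup.mem_comap, blockHom_simple]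
        exact hS _
      exact Subgroup.mem_comap.mp (this ▸ Subgroup.mem_top h)
    -- The rows in `S` are stable under the block, by conjugation. From `e_0` the action of the
    -- simple matrices then produces every `e_i`.
    let W : AddSubgroup (Fin m → ZMod p) := Subgroup.toAddSubgroup' (S.comap rowHom)
    have hW : ∀ w, w ∈ W ↔ rowHom (.ofAdd w) ∈ S := fun _ => Iff.rfl
    have hvec : ∀ w h, w ∈ W → Matrix.vecMul w (toMatrix h) ∈ W := by
      intro w h hw
      rw [hW] at hw ⊢
      rw [eq_inv_mul_of_mul_eq (rowHom_mul_blockHom h w).symm]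
      exact S.mul_mem (S.inv_mem (hblock h)) (S.mul_mem hw (hblock h))
    have hstd : ∀ i, stdRow m (ZMod p) i ∈ W := by
      intro i
      induction i with
      | zero =>
        rw [hW, rowHom_stdRow_zero]
        exact hS 0
      | succ i hi =>
        have := hvec _ (simple m (ZMod p) i) hi
        rw [stdRow_vecMul_self] at this
        exact (W.add_mem_cancel_left hi).mp this
    have hWtop := addSubgroup_eq_top_of_stdRow_mem W hstd
    rw [eq_top_iff]
    intro g _
    rw [← bordered_block_row g, ← toAdd_ofAdd (row g), ← blockHom_mul_rowHom]
    exact S.mul_mem (hblock _) ((hW _).mp (hWtop ▸ AddSubgroup.mem_top _))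

end unitriangularGroup

/-! ### Lifting homomorphisms from unitriangular groups -/

/-- Pairwise commuting elements of exponent `p` define a homomorphism from `(ℤ/p)ⁿ`. -/
theorem exists_hom_of_pairwise_commute {E : Type*} [Group E] {p n : ℕ} (τ : ℕ → E)
    (hτ : ∀ i j, Commute (τ i) (τ j)) (hp : ∀ i, τ i ^ p = 1) :
    ∃ t : Multiplicative (Fin n → ZMod p) →* E,
      ∀ i : Fin n, t (.ofAdd (Pi.single i 1)) = τ i := by
  let f (i : Fin n) : ZMod p →+ Additive E :=
    ZMod.lift p ⟨zmultiplesHom (Additive E) (.ofMul (τ i)), by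
      simp only [zmultiplesHom_apply, natCast_zsmul]
      exact hp i⟩
  have hf (i : Fin n) (z : ℤ) : f i z = .ofMul (τ i ^ z) := by
    simp only [f, ZMod.lift_coe, zmultiplesHom_apply, ofMul_zpow]
  have hcomm : Pairwise fun i j => ∀ x y, AddCommute (f i x) (f j y) := by
    intro i j _ x y
    obtain ⟨x, rfl⟩ := ZMod.intCast_surjective x
    obtain ⟨y, rfl⟩ := ZMod.intCast_surjective y
    rw [hf, hf]
    exact ((hτ i j).zpow_zpow x y)
  refine ⟨AddMonoidHom.toMultiplicativeLeft (AddMonoidHom.noncommPiCoprod f hcomm), fun i => ?_⟩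
  have h1 := AddMonoidHom.noncommPiCoprod_single f (hcomm := hcomm) i (1 : ZMod p)
  have h2 := hf i 1
  rw [Int.cast_one, zpow_one] at h2
  exact h1.trans h2

/-- Homomorphisms on `(ℤ/p)ⁿ` which agree on the standard rows are equal. -/
theorem eq_of_eq_stdRow {E : Type*} [Group E] {p n : ℕ}
    {f g : Multiplicative (Fin n → ZMod p) →* E}
    (h : ∀ i, f (.ofAdd (unitriangularGroup.stdRow n (ZMod p) i)) =
      g (.ofAdd (unitriangularGroup.stdRow n (ZMod p) i))) : f = g := by
  have := unitriangularGroup.addSubgroup_eq_top_of_stdRow_mem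
    (Subgroup.toAddSubgroup' (f.eqLocus g)) h
  refine MonoidHom.ext fun w => ?_
  have hw : w.toAdd ∈ Subgroup.toAddSubgroup' (f.eqLocus g) := this ▸ AddSubgroup.mem_top _
  exact hw

namespace unitriangularGroup

/-- Multiplication by a unitriangular matrix from the right, on row vectors. -/
def vecMulHom {R : Type} [CommRing R] {n : ℕ} (h : unitriangularGroup n R) :
    Multiplicative (Fin n → R) →* Multiplicative (Fin n → R) :=
  AddMonoidHom.toMultiplicative
    { toFun := fun w => Matrix.vecMul w (toMatrix h)
      map_zero' := Matrix.zero_vecMul _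
      map_add' := fun _ _ => Matrix.add_vecMul _ _ _ }

theorem vecMulHom_ofAdd {R : Type} [CommRing R] {n : ℕ} (h : unitriangularGroup n R)
    (w : Fin n → R) : vecMulHom h (.ofAdd w) = .ofAdd (Matrix.vecMul w (toMatrix h)) := rfl

theorem vecMulHom_one {R : Type} [CommRing R] {n : ℕ} (w : Multiplicative (Fin n → R)) :
    vecMulHom 1 w = w :=
  congrArg Multiplicative.ofAdd (Matrix.vecMul_one w.toAdd)

theorem vecMulHom_mul {R : Type} [CommRing R] {n : ℕ} (g h : unitriangularGroup n R)
    (w : Multiplicative (Fin n → R)) : vecMulHom (g * h) w = vecMulHom h (vecMulHom g w) :=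
  congrArg Multiplicative.ofAdd (Matrix.vecMul_vecMul w.toAdd (toMatrix g) (toMatrix h)).symm

theorem rowHom_mul_blockHom' {R : Type} [CommRing R] {n : ℕ} (h : unitriangularGroup n R)
    (w : Multiplicative (Fin n → R)) :
    rowHom w * blockHom h = blockHom h * rowHom (vecMulHom h w) :=
  rowHom_mul_blockHom h w.toAdd

/-- A homomorphism of `UT_n` to the base of a commutativity preserving extension with divisible
kernel lifts to the extension, if it lifts on the lower right block. -/
theorem exists_lift_succ {p : ℕ} {E G : Type*} [Group E] [Group G] (π : E →* G)
    (hπ : Function.Surjective π)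
    (hdiv : ∀ a ∈ π.ker, ∃ b ∈ π.ker, b ^ p = a)
    (hcomm : ∀ a b, Commute (π a) (π b) → Commute a b) {m : ℕ}
    (φ : unitriangularGroup (m + 1) (ZMod p) →* G)
    (s : unitriangularGroup m (ZMod p) →* E) (hs : π.comp s = φ.comp blockHom) :
    ∃ s' : unitriangularGroup (m + 1) (ZMod p) →* E, π.comp s' = φ := by
  let e (i : ℕ) : Multiplicative (Fin m → ZMod p) := .ofAdd (stdRow m (ZMod p) i)
  let x (i : ℕ) : unitriangularGroup m (ZMod p) := simple m (ZMod p) i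
  have hs (h) : π (s h) = φ (blockHom h) := DFunLike.congr_fun hs h
  have hep (i) : e i ^ p = 1 := by
    change Multiplicative.ofAdd (p • stdRow m (ZMod p) i) = 1
    rw [← Nat.cast_smul_eq_nsmul (ZMod p), CharP.cast_eq_zero, zero_smul, ofAdd_zero]
  have hconj (h) (w) :
      (φ (blockHom h))⁻¹ * φ (rowHom w) * φ (blockHom h) = φ (rowHom (vecMulHom h w)) := by
    rw [mul_assoc, ← map_mul φ (rowHom w), rowHom_mul_blockHom', map_mul, inv_mul_cancel_left]
  -- For any lift `y`, the power `y ^ p` lies in the kernel, which is central by `hcomm`; dividing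
  -- `y` by a `p`-th root of it in the kernel makes the exponent `p`.
  obtain ⟨τ₀, hτ₀, hτ₀p⟩ : ∃ τ₀, π τ₀ = φ (rowHom (e 0)) ∧ τ₀ ^ p = 1 := by
    obtain ⟨y, hy⟩ := hπ (φ (rowHom (e 0)))
    obtain ⟨b, hb, hbp⟩ := hdiv (y ^ p) (by
      rw [MonoidHom.mem_ker, map_pow, hy, ← map_pow, ← map_pow, hep, map_one, map_one])
    rw [MonoidHom.mem_ker] at hb
    have hyb : Commute y b⁻¹ := hcomm _ _ (by rw [map_inv, hb, inv_one]; exact Commute.one_right _)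
    refine ⟨y * b⁻¹, by rw [map_mul, map_inv, hb, inv_one, mul_one, hy], ?_⟩
    rw [hyb.mul_pow, inv_pow, hbp, mul_inv_cancel]
  -- Since `e_i x_i = e_i + e_{i+1}`, the lift of `e_{i+1}` is forced by that of `e_i`.
  let τ (i : ℕ) : E := Nat.rec τ₀ (fun i y => y⁻¹ * ((s (x i))⁻¹ * y * s (x i))) i
  have hτsucc (i) : τ (i + 1) = (τ i)⁻¹ * ((s (x i))⁻¹ * τ i * s (x i)) := rfl
  have hvec (i) : vecMulHom (x i) (e i) = e i * e (i + 1) :=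
    congrArg Multiplicative.ofAdd (stdRow_vecMul_self i)
  have hτ (i) : π (τ i) = φ (rowHom (e i)) := by
    induction i with
    | zero => exact hτ₀
    | succ i ih =>
      rw [hτsucc, map_mul, map_mul, map_mul, map_inv, map_inv, ih, hs, hconj, hvec, map_mul,
        map_mul, inv_mul_cancel_left]
  have hrow (v w) : Commute (φ (rowHom v)) (φ (rowHom w)) :=
    ((Commute.all v w).map rowHom).map φ
  have hτp (i) : τ i ^ p = 1 := by
    induction i with
    | zero => exact hτ₀p
    | succ i ih =>
      -- Both factors of `τ (i + 1)` lie over rows, so they commute and the `p`-th power can be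
      -- taken factor by factor.
      have hc : Commute (τ i)⁻¹ ((s (x i))⁻¹ * τ i * s (x i)) := hcomm _ _ (by
        rw [map_mul, map_mul, map_inv, map_inv, hτ, hs, hconj, ← map_inv, ← map_inv]
        exact hrow _ _)
      have := conj_pow (a := (s (x i))⁻¹) (b := τ i) (i := p)
      rw [inv_inv] at this
      rw [hτsucc, hc.mul_pow, inv_pow, this, ih, inv_one, one_mul, mul_one, inv_mul_cancel]
  obtain ⟨t, ht⟩ := exists_hom_of_pairwise_commute (n := m) τ
    (fun i j => hcomm _ _ (by rw [hτ, hτ]; exact hrow _ _)) hτp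
  have ht (i : ℕ) (hi : i < m) : t (e i) = τ i := by
    lift i to Fin m using hi
    rw [← ht i, ← stdRow_coe]
  have hπt (w) : π (t w) = φ (rowHom w) := by
    have : π.comp t = φ.comp rowHom := eq_of_eq_stdRow fun i => by
      rcases lt_or_ge i m with hi | hi
      · exact (congrArg π (ht i hi)).trans (hτ i)
      · rw [stdRow_of_le hi, ofAdd_zero, map_one, map_one]
    exact DFunLike.congr_fun this w
  -- The elements satisfying the semidirect product relation form a subgroup, so it is enough to
  -- check simple matrices against standard rows.
  let S : Subgroup (unitriangularGroup m (ZMod p)) :=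
    { carrier := {h | ∀ w, t w * s h = s h * t (vecMulHom h w)}
      one_mem' := fun w => by rw [map_one, vecMulHom_one, mul_one, one_mul]
      mul_mem' := fun {g h} hg hh w => by
        rw [map_mul, ← mul_assoc, hg, mul_assoc, hh, mul_assoc, vecMulHom_mul]
      inv_mem' := fun {h} hh w => by
        have := hh (vecMulHom h⁻¹ w)
        rw [← vecMulHom_mul, inv_mul_cancel, vecMulHom_one] at this
        rw [map_inv, mul_inv_eq_iff_eq_mul, mul_assoc, this, inv_mul_cancel_left] }
  have hS : S = ⊤ := by
    refine eq_top_of_simple_mem S fun i w => ?_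
    have : (MulAut.conj (s (x i))⁻¹).toMonoidHom.comp t = t.comp (vecMulHom (x i)) := by
      refine eq_of_eq_stdRow fun j => ?_
      change (s (x i))⁻¹ * t (e j) * (s (x i))⁻¹⁻¹ = t (vecMulHom (x i) (e j))
      rw [inv_inv]
      -- For `j = i` the relation is the recursion for `τ`, or is trivial at the boundary; for `j ≠
      -- i` the matrix fixes the row, so the images commute and hence the lifts do.
      by_cases hji : j = i
      · subst hji
        rw [hvec, map_mul]
        rcases lt_or_ge (j + 1) m with hj | hj
        · rw [ht _ hj, ht _ (by omega), hτsucc, mul_inv_cancel_left]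
        · have h1 : x j = 1 := toMatrix_injective <| by
            ext a b
            rw [toMatrix_simple, toMatrix_one, Matrix.one_apply,
              if_neg (show ¬ ((a : ℕ) = j ∧ (b : ℕ) = j + 1) by omega)]
          have h2 : e (j + 1) = 1 := congrArg Multiplicative.ofAdd (stdRow_of_le hj)
          rw [h1, h2, map_one, map_one, inv_one, one_mul]
      · have hfix : vecMulHom (x i) (e j) = e j :=
          congrArg Multiplicative.ofAdd (stdRow_vecMul_of_ne hji)
        rw [hfix]
        have : Commute (t (e j)) (s (x i)) := hcomm _ _ (by
          rw [hπt, hs, commute_iff_eq, ← map_mul, ← map_mul, rowHom_mul_blockHom', hfix])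
        rw [mul_assoc, this.eq, inv_mul_cancel_left]
    have := DFunLike.congr_fun this w
    change (s (x i))⁻¹ * t w * (s (x i))⁻¹⁻¹ = t (vecMulHom (x i) w) at this
    change t w * s (x i) = s (x i) * t (vecMulHom (x i) w)
    rw [← this, inv_inv, mul_assoc, mul_inv_cancel_left]
  have hts (h) (w) : t w * s h = s h * t (vecMulHom h w) := by
    have : h ∈ S := hS ▸ Subgroup.mem_top h
    exact this w
  refine ⟨MonoidHom.mk' (fun g => s (block g) * t (.ofAdd (row g))) fun g g' => ?_, ?_⟩
  · rw [block_mul, row_mul, map_mul, ofAdd_add, mul_comm (Multiplicative.ofAdd (row g')), map_mul,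
      ← vecMulHom_ofAdd, mul_assoc, mul_assoc, ← mul_assoc (s (block g')), ← hts, mul_assoc]
  · ext g
    change π (s (block g) * t (.ofAdd (row g))) = φ g
    rw [map_mul, hs, hπt, ← map_mul, blockHom_mul_rowHom, toAdd_ofAdd, bordered_block_row]

/-- A homomorphism of `UT_n` to the base of a commutativity preserving extension with divisible
kernel lifts to the extension. -/
theorem exists_lift {p : ℕ} {E G : Type*} [Group E] [Group G] (π : E →* G)
    (hπ : Function.Surjective π)
    (hdiv : ∀ a ∈ π.ker, ∃ b ∈ π.ker, b ^ p = a)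
    (hcomm : ∀ a b, Commute (π a) (π b) → Commute a b) {n : ℕ}
    (φ : unitriangularGroup n (ZMod p) →* G) :
    ∃ s : unitriangularGroup n (ZMod p) →* E, π.comp s = φ := by
  induction n with
  | zero =>
    refine ⟨1, MonoidHom.ext fun g => ?_⟩
    rw [show g = 1 from toMatrix_injective (Subsingleton.elim _ _), map_one, map_one]
  | succ m ih =>
    obtain ⟨s, hs⟩ := ih (φ.comp blockHom)
    exact exists_lift_succ π hπ hdiv hcomm φ s hs

end unitriangularGroup

/-! ### Two-generated abelian groups are bicyclic -/

theorem Module.Basis.SmithNormalForm.repr_smul_mem {R M ι : Type*} [CommRing R] [AddCommGroup M]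
    [Module R M] {N : Submodule R M} {n : ℕ} (snf : Module.Basis.SmithNormalForm N ι n) {m : M}
    (hm : m ∈ N) (i : ι) : snf.bM.repr m i • snf.bM i ∈ N := by
  by_cases hi : i ∈ Set.range snf.f
  · obtain ⟨j, rfl⟩ := hi
    have h := snf.repr_apply_embedding_eq_repr_smul ⟨m, hm⟩ (i := j)
    rw [map_smul, Finsupp.smul_apply, smul_eq_mul, mul_comm] at h
    change snf.bM.repr m (snf.f j) = _ at h
    rw [h, mul_smul, ← snf.snf]
    exact N.smul_mem _ (snf.bN j).2
  · rw [show snf.bM.repr m i = 0 from snf.repr_eq_zero_of_notMem_range ⟨m, hm⟩ hi, zero_smul]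
    exact N.zero_mem

/-- An abelian group generated by two elements is bicyclic. -/
theorem isBicyclic_of_closure_pair {A : Type} [CommGroup A] (g h : A)
    (hgh : Subgroup.closure {g, h} = ⊤) : IsBicyclic A := by
  let F : (Fin 2 → ℤ) →ₗ[ℤ] Additive A :=
    Fintype.linearCombination ℤ ![Additive.ofMul g, Additive.ofMul h]
  have hF (v) : (F v).toMul = g ^ v 0 * h ^ v 1 := by
    simp [F, Fintype.linearCombination_apply, Fin.sum_univ_two]
  -- In a basis of `ℤ²` adapted to the relations, a relation `c ^ x * d ^ y = 1` splits into `c ^ x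
  -- = 1` and `d ^ y = 1`, so the product of `⟨c⟩` and `⟨d⟩` is direct.
  obtain ⟨n, snf⟩ := Submodule.smithNormalForm (Pi.basisFun ℤ (Fin 2)) (LinearMap.ker F)
  let c : A := (F (snf.bM 0)).toMul
  let d : A := (F (snf.bM 1)).toMul
  have hcd (x y : ℤ) : (F (x • snf.bM 0 + y • snf.bM 1)).toMul = c ^ x * d ^ y := by
    rw [map_add, map_smul, map_smul]
    rfl
  refine Or.inr ⟨Subgroup.zpowers c, Subgroup.zpowers d, inferInstance, inferInstance,
    ⟨(MulEquiv.ofBijective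
      ((Subgroup.zpowers c).subtype.coprod (Subgroup.zpowers d).subtype) ⟨?_, ?_⟩).symm⟩⟩
  · rw [injective_iff_map_eq_one]
    rintro ⟨⟨_, x, rfl⟩, ⟨_, y, rfl⟩⟩ hxy
    change c ^ x * d ^ y = 1 at hxy
    have hmem : x • snf.bM 0 + y • snf.bM 1 ∈ LinearMap.ker F := by
      rw [LinearMap.mem_ker]
      exact Additive.toMul.injective ((hcd x y).trans hxy)
    have h0 := snf.repr_smul_mem hmem 0
    have h1 : c ^ x = 1 := by
      rw [show snf.bM.repr (x • snf.bM 0 + y • snf.bM 1) 0 = x by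
        rw [map_add, map_smul, map_smul, Module.Basis.repr_self, Module.Basis.repr_self]
        simp, LinearMap.mem_ker] at h0
      have := hcd x 0
      rw [zero_smul, add_zero, h0, zpow_zero, mul_one] at this
      exact this.symm
    rw [h1, one_mul] at hxy
    exact Prod.ext (Subtype.ext h1) (Subtype.ext hxy)
  · intro a
    obtain ⟨m, n, hmn⟩ := Subgroup.mem_closure_pair.mp (hgh ▸ Subgroup.mem_top a)
    refine ⟨(⟨c ^ snf.bM.repr ![m, n] 0, _, rfl⟩, ⟨d ^ snf.bM.repr ![m, n] 1, _, rfl⟩), ?_⟩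
    change c ^ snf.bM.repr ![m, n] 0 * d ^ snf.bM.repr ![m, n] 1 = a
    have := snf.bM.sum_repr ![m, n]
    rw [Fin.sum_univ_two] at this
    rw [← hcd, this, hF]
    exact hmn

theorem isBicyclic_closure_pair {G : Type} [Group G] {g h : G} (hgh : Commute g h) :
    IsBicyclic (Subgroup.closure {g, h}) := by
  have hcomm : ∀ x ∈ ({g, h} : Set G), ∀ y ∈ ({g, h} : Set G), x * y = y * x := by
    rintro x (rfl | rfl) y (rfl | rfl)
    exacts [rfl, hgh, hgh.symm, rfl]
  let _ : CommGroup (Subgroup.closure {g, h}) :=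
    { mul_comm := (Subgroup.isMulCommutative_closure hcomm).is_comm.comm }
  have hg : g ∈ Subgroup.closure {g, h} := Subgroup.subset_closure (by simp)
  have hh : h ∈ Subgroup.closure {g, h} := Subgroup.subset_closure (by simp)
  refine isBicyclic_of_closure_pair (A := Subgroup.closure {g, h}) ⟨g, hg⟩ ⟨h, hh⟩ ?_
  rw [eq_top_iff]
  rintro ⟨x, hx⟩ -
  induction hx using Subgroup.closure_induction with
  | mem x hx =>
    rcases hx with rfl | rfl
    · exact Subgroup.subset_closure (by simp)
    · exact Subgroup.subset_closure (by simp)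
  | one => exact Subgroup.one_mem _
  | mul x y hx hy ihx ihy => exact Subgroup.mul_mem _ ihx ihy
  | inv x hx ihx => exact Subgroup.inv_mem _ ihx

/-! ### Bogomolov multiplier and commutativity preserving extensions -/

/-- The central extension of `G` by `A` defined by a `2`-cocycle for the trivial action. -/
@[ext]
structure CocycleExtension {G A : Type} [Group G] [AddCommGroup A] {f : G × G → A}
    (hf : ∀ g h j, f (g * h, j) + f (g, h) = f (h, j) + f (g, h * j)) where
  /-- The component in the kernel. -/
  fiber : A
  /-- The component in the quotient. -/
  base : G

namespace CocycleExtension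

variable {G A : Type} [Group G] [AddCommGroup A] {f : G × G → A}
  {hf : ∀ g h j, f (g * h, j) + f (g, h) = f (h, j) + f (g, h * j)}

instance : Mul (CocycleExtension hf) :=
  ⟨fun x y => ⟨x.fiber + y.fiber + f (x.base, y.base), x.base * y.base⟩⟩

/-- The cocycle is not assumed normalised, whence the corrections by `f (1, 1)` here, in inverses
and in `incl`. -/
instance : One (CocycleExtension hf) := ⟨⟨-f (1, 1), 1⟩⟩

instance : Inv (CocycleExtension hf) :=
  ⟨fun x => ⟨-x.fiber - f (x.base⁻¹, x.base) - f (1, 1), x.base⁻¹⟩⟩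

theorem fiber_mul (x y : CocycleExtension hf) :
    (x * y).fiber = x.fiber + y.fiber + f (x.base, y.base) := rfl

theorem base_mul (x y : CocycleExtension hf) : (x * y).base = x.base * y.base := rfl

theorem fiber_one : (1 : CocycleExtension hf).fiber = -f (1, 1) := rfl

theorem base_one : (1 : CocycleExtension hf).base = 1 := rfl

theorem fiber_inv (x : CocycleExtension hf) :
    x⁻¹.fiber = -x.fiber - f (x.base⁻¹, x.base) - f (1, 1) := rfl

theorem base_inv (x : CocycleExtension hf) : x⁻¹.base = x.base⁻¹ := rfl

instance : Group (CocycleExtension hf) :=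
  Group.ofLeftAxioms
    (fun x y z => by
      ext
      · simp only [fiber_mul, base_mul]
        rw [show x.fiber + y.fiber + f (x.base, y.base) + z.fiber + f (x.base * y.base, z.base) =
          x.fiber + y.fiber + z.fiber + (f (x.base * y.base, z.base) + f (x.base, y.base)) by abel,
          hf]
        abel
      · exact mul_assoc _ _ _)
    (fun x => by
      ext
      · have := hf 1 1 x.base
        rw [one_mul, one_mul, add_right_inj] at this
        rw [fiber_mul, fiber_one, base_one, ← this]
        abel
      · exact one_mul _)
    (fun x => by
      ext
      · rw [fiber_mul, fiber_inv, base_inv, fiber_one]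
        abel
      · exact inv_mul_cancel _)

variable (hf) in
/-- The projection of an extension to its base. -/
def proj : CocycleExtension hf →* G := MonoidHom.mk' base base_mul

variable (hf) in
/-- The inclusion of the kernel in an extension. -/
def incl : Multiplicative A →* CocycleExtension hf :=
  MonoidHom.mk' (fun a => ⟨a.toAdd - f (1, 1), 1⟩) fun a b => by
    ext
    · change a.toAdd + b.toAdd - f (1, 1) = a.toAdd - f (1, 1) + (b.toAdd - f (1, 1)) + f (1, 1)
      abel
    · rw [base_mul, one_mul]

theorem proj_surjective : Function.Surjective (proj hf) := fun g => ⟨⟨0, g⟩, rfl⟩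

theorem exists_incl_eq {x : CocycleExtension hf} (hx : x ∈ (proj hf).ker) :
    ∃ a, incl hf a = x :=
  ⟨.ofAdd (x.fiber + f (1, 1)), CocycleExtension.ext (add_sub_cancel_right _ _) hx.symm⟩

theorem incl_mem_ker (a : Multiplicative A) : incl hf a ∈ (proj hf).ker := rfl

end CocycleExtension

theorem AddCircle.exists_nsmul_eq {m : ℕ} (hm : m ≠ 0) (a : AddCircle (1 : ℚ)) :
    ∃ b, m • b = a := by
  obtain ⟨q, rfl⟩ := QuotientAddGroup.mk_surjective a
  refine ⟨((q / m : ℚ) : AddCircle (1 : ℚ)), ?_⟩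
  rw [← AddCircle.coe_nsmul, nsmul_eq_mul, mul_div_cancel₀ q (Nat.cast_ne_zero.mpr hm)]

open groupCohomology in
/-- A cocycle whose class is in the Bogomolov multiplier is symmetric on commuting pairs. -/
theorem symm_of_mem_bogomolovMultiplier {G : Type} [Group G] (f : cocycles₂ (trivialQModZ G))
    (hf : H2π (trivialQModZ G) f ∈ bogomolovMultiplier G) {g h : G} (hgh : Commute g h) :
    f (g, h) = f (h, g) := by
  let A := Subgroup.closure {g, h}
  have hA : resH2 A (H2π (trivialQModZ G) f) = 0 := by
    rw [bogomolovMultiplier, Submodule.mem_iInf] at hf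
    exact LinearMap.mem_ker.mp ((Submodule.mem_iInf _).mp (hf A) (isBicyclic_closure_pair hgh))
  have hres : H2π (trivialQModZ A) (mapCocycles₂ A.subtype
      (CategoryTheory.CategoryStruct.id (trivialQModZ A)) f) = 0 := by
    rw [← hA]
    exact (H2π_comp_map_apply (A := trivialQModZ G) (B := trivialQModZ A) A.subtype
      (CategoryTheory.CategoryStruct.id (trivialQModZ A)) f).symm
  rw [H2π_eq_zero_iff] at hres
  obtain ⟨x, hx⟩ := hres
  -- A coboundary for the trivial action is symmetric in `a` and `b` once `a * b = b * a`.
  have hx (a b : A) : f ((a : G), (b : G)) = x b - x (a * b) + x a :=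
    (congrFun hx (a, b)).symm
  have h1 := hx ⟨g, Subgroup.subset_closure (by simp)⟩ ⟨h, Subgroup.subset_closure (by simp)⟩
  have h2 := hx ⟨h, Subgroup.subset_closure (by simp)⟩ ⟨g, Subgroup.subset_closure (by simp)⟩
  refine h1.trans (Eq.trans ?_ h2.symm)
  simp only [MulMemClass.mk_mul_mk, hgh.eq]
  abel

open groupCohomology in
/-- If every commutativity preserving extension of `G` with divisible kernel splits, then the
Bogomolov multiplier of `G` is trivial. -/
theorem bogomolovMultiplier_eq_bot_of_splits {G : Type} [Group G]
    (H : ∀ (E : Type) [Group E] (π : E →* G), Function.Surjective π →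
      (∀ m : ℕ, m ≠ 0 → ∀ a ∈ π.ker, ∃ b ∈ π.ker, b ^ m = a) →
      (∀ a b, Commute (π a) (π b) → Commute a b) →
      ∃ s : G →* E, π.comp s = MonoidHom.id G) : bogomolovMultiplier G = ⊥ := by
  rw [eq_bot_iff]
  intro c hc
  rw [Submodule.mem_bot]
  induction c using H2_induction_on with
  | h f =>
  let f' : G × G → AddCircle (1 : ℚ) := f
  have hf : ∀ g h j, f' (g * h, j) + f' (g, h) = f' (h, j) + f' (g, h * j) :=
    (mem_cocycles₂_iff (A := trivialQModZ G) f).1 f.2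
  obtain ⟨s, hs⟩ := H (CocycleExtension hf) (CocycleExtension.proj hf)
    CocycleExtension.proj_surjective
    (fun m hm a ha => by
      obtain ⟨a, rfl⟩ := CocycleExtension.exists_incl_eq ha
      obtain ⟨b, hb⟩ := AddCircle.exists_nsmul_eq hm a.toAdd
      refine ⟨CocycleExtension.incl hf (.ofAdd b), CocycleExtension.incl_mem_ker _, ?_⟩
      rw [← map_pow, ← ofAdd_nsmul, hb, ofAdd_toAdd])
    (fun a b hab => by
      refine CocycleExtension.ext ?_ hab
      rw [CocycleExtension.fiber_mul, CocycleExtension.fiber_mul, add_comm a.fiber]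
      exact congrArg _ (symm_of_mem_bogomolovMultiplier f hc hab))
  have hs (g) : (s g).base = g := DFunLike.congr_fun hs g
  rw [H2π_eq_zero_iff]
  -- Multiplicativity of `s` reads `fiber (gh) = fiber g + fiber h + f (g, h)`, which explains the
  -- sign.
  refine ⟨fun g => -(s g).fiber, ?_⟩
  funext ⟨g, h⟩
  change -(s h).fiber - -(s (g * h)).fiber + -(s g).fiber = f' (g, h)
  rw [map_mul, CocycleExtension.fiber_mul, hs, hs]
  abel

/-! ### Central elements of unitriangular groups -/

namespace unitriangularGroup

variable {R : Type} [CommRing R] {n : ℕ}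

/-- The elementary unitriangular matrix with entry `c` in position `(i, j)`. -/
noncomputable def elementary {i j : Fin n} (hij : i < j) (c : R) : unitriangularGroup n R :=
  ofMatrix (1 + Matrix.single i j c)
    (fun a => by
      rw [Matrix.add_apply, Matrix.one_apply_eq, Matrix.single_apply_of_ne, add_zero]
      rintro ⟨rfl, rfl⟩
      exact hij.false)
    (fun a b hab => by
      rw [Matrix.add_apply, Matrix.one_apply_ne hab.ne', Matrix.single_apply_of_ne, add_zero]
      rintro ⟨rfl, rfl⟩
      exact (hij.trans hab).false)

theorem toMatrix_elementary {i j : Fin n} (hij : i < j) (c : R) :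
    toMatrix (elementary hij c) = 1 + Matrix.single i j c := rfl

theorem elementary_mul_elementary {i j l : Fin n} (hij : i < j) (hjl : j < l) (c d : R) :
    elementary hij c * elementary hjl d =
      elementary (hij.trans hjl) (c * d) * (elementary hjl d * elementary hij c) := by
  apply toMatrix_injective
  simp only [toMatrix_mul, toMatrix_elementary, mul_add, add_mul, one_mul, mul_one,
    Matrix.single_mul_single_same]
  rw [Matrix.single_mul_single_of_ne _ _ _ _ (hij.trans hjl).ne',
    Matrix.single_mul_single_of_ne _ _ _ _ (hij.trans hjl).ne',
    Matrix.single_mul_single_of_ne _ _ _ _ hjl.ne']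
  simp only [add_zero, mul_zero]
  abel

/-- Commuting with `1 + E_ij` means commuting with `E_ij`, which kills the off-diagonal entries in
column `i` and row `j`. Taking `j` last, and then `i = 0`, leaves only the corner. -/
theorem eq_elementary_of_mem_center {z : unitriangularGroup (n + 2) R}
    (hz : z ∈ Subgroup.center (unitriangularGroup (n + 2) R)) :
    z = elementary (Fin.last_pos : 0 < Fin.last (n + 1)) (toMatrix z 0 (Fin.last _)) := by
  have hcomm {i j : Fin (n + 2)} (hij : i < j) : Commute (Matrix.single i j 1) (toMatrix z) := by
    have := congrArg toMatrix (Subgroup.mem_center_iff.mp hz (elementary hij 1))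
    rw [toMatrix_mul, toMatrix_mul, toMatrix_elementary, add_mul, mul_add, one_mul, mul_one,
      add_right_inj] at this
    exact this
  apply toMatrix_injective
  ext a b
  rw [toMatrix_elementary, Matrix.add_apply]
  by_cases hab : a = b
  · subst hab
    rw [toMatrix_diag, Matrix.one_apply_eq, Matrix.single_apply_of_ne, add_zero]
    rintro ⟨h1, h2⟩
    exact Fin.last_pos.ne (h1.trans h2.symm)
  · rw [Matrix.one_apply_ne hab, zero_add]
    by_cases ha : a = 0
    · subst ha
      by_cases hb : b = Fin.last _
      · rw [hb, Matrix.single_apply_same]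
      · rw [Matrix.single_apply_of_ne _ _ _ _ _ fun h => hb h.2.symm]
        exact Matrix.col_eq_zero_of_commute_single (hcomm (Fin.lt_last_iff_ne_last.mpr hb)) hab
    · rw [Matrix.single_apply_of_ne _ _ _ _ _ fun h => ha h.1.symm]
      exact Matrix.row_eq_zero_of_commute_single (hcomm (Fin.pos_iff_ne_zero.mpr ha)) (Ne.symm hab)

/-- For `n ≥ 3`, every central element of `UT_n` is a commutator. -/
theorem exists_commutator_of_mem_center {z : unitriangularGroup (n + 3) R}
    (hz : z ∈ Subgroup.center (unitriangularGroup (n + 3) R)) :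
    ∃ u x : unitriangularGroup (n + 3) R, u * x = z * (x * u) := by
  have h01 : (0 : Fin (n + 3)) < 1 := Fin.zero_lt_one
  have h1l : (1 : Fin (n + 3)) < Fin.last (n + 2) := by
    rw [Fin.lt_def]
    simp
  refine ⟨elementary h01 (toMatrix z 0 (Fin.last _)), elementary h1l 1, ?_⟩
  rw [elementary_mul_elementary, mul_one, ← eq_elementary_of_mem_center hz]

theorem card_two {p : ℕ} : Nat.card (unitriangularGroup 2 (ZMod p)) = p := by
  refine (Nat.card_congr (Equiv.ofBijective (fun g => toMatrix g 0 1)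
    ⟨fun g g' h => ?_, fun c => ?_⟩)).trans (Nat.card_zmod p)
  · refine ext_succ (fun j => ?_) (fun i j => ?_)
    · rw [Subsingleton.elim j 0]
      exact h
    · rw [Subsingleton.elim i j, toMatrix_diag, toMatrix_diag]
  · refine ⟨elementary Fin.zero_lt_one c, ?_⟩
    change toMatrix (elementary _ c) 0 1 = c
    simp [toMatrix_elementary]

/-- A central subgroup of a group `UT_n(𝔽_p)` with `n ≥ 2` is trivial or the whole group, or
consists of commutators. -/
theorem subgroup_center_cases {p : ℕ} [Fact p.Prime] (hn : 2 ≤ n) {G : Type*} [Group G]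
    (e : G ≃* unitriangularGroup n (ZMod p)) {K : Subgroup G} (hK : K ≤ Subgroup.center G) :
    K = ⊥ ∨ K = ⊤ ∨ ∀ z ∈ K, ∃ u x : G, u * x = z * (x * u) := by
  rcases hn.eq_or_lt with rfl | hn
  -- `UT_2` is abelian, so its nontrivial elements are not commutators; its prime order is used
  -- instead.
  · have : Fact (Nat.card G).Prime := by
      rw [Nat.card_congr e.toEquiv, card_two]
      infer_instance
    exact (Subgroup.eq_bot_or_eq_top_of_prime_card K).imp_right Or.inl
  · obtain ⟨m, rfl⟩ := Nat.exists_eq_add_of_le' (show 3 ≤ n from hn)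
    refine Or.inr (Or.inr fun z hz => ?_)
    have hez : e z ∈ Subgroup.center (unitriangularGroup (m + 3) (ZMod p)) := by
      rw [Subgroup.mem_center_iff]
      intro g
      obtain ⟨g, rfl⟩ := e.surjective g
      rw [← map_mul, ← map_mul, Subgroup.mem_center_iff.mp (hK hz)]
    obtain ⟨u, x, h⟩ := exists_commutator_of_mem_center hez
    refine ⟨e.symm u, e.symm x, e.injective ?_⟩
    simpa using h

end unitriangularGroup

/-! ### Splitting over the central product -/

section CentralProduct

variable {G₁ G₂ : Type} [Group G₁] [Group G₂] {K₁ : Subgroup G₁} {K₂ : Subgroup G₂}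

/-- A commutativity preserving extension of a central product splits if it splits over both
factors and the splittings agree on the amalgamated subgroup. -/
theorem CentralProduct.exists_section {hK₁ : K₁ ≤ Subgroup.center G₁}
    {hK₂ : K₂ ≤ Subgroup.center G₂} {θ : K₁ ≃* K₂} {E : Type*} [Group E]
    {π : E →* CentralProduct hK₁ hK₂ θ} (hcomm : ∀ a b, Commute (π a) (π b) → Commute a b)
    {s₁ : G₁ →* E} {s₂ : G₂ →* E}
    (h₁ : π.comp s₁ = (QuotientGroup.mk' (amalgam hK₁ hK₂ θ)).comp (MonoidHom.inl G₁ G₂))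
    (h₂ : π.comp s₂ = (QuotientGroup.mk' (amalgam hK₁ hK₂ θ)).comp (MonoidHom.inr G₁ G₂))
    (hK : ∀ (a : K₁) (b : K₂), θ a = b⁻¹ →
      (s₁ a * s₂ b = 1 ∨ (∃ u x : G₁, u * x = a * (x * u)) ∧ ∃ v y : G₂, v * y = b * (y * v))) :
    ∃ s : CentralProduct hK₁ hK₂ θ →* E, π.comp s = MonoidHom.id _ := by
  have h₁ (a) : π (s₁ a) = QuotientGroup.mk' (amalgam hK₁ hK₂ θ) (a, 1) :=
    DFunLike.congr_fun h₁ a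
  have h₂ (b) : π (s₂ b) = QuotientGroup.mk' (amalgam hK₁ hK₂ θ) (1, b) :=
    DFunLike.congr_fun h₂ b
  let S : G₁ × G₂ →* E := s₁.noncommCoprod s₂ fun a b => hcomm _ _ (by
    rw [h₁, h₂]
    exact (MonoidHom.commute_inl_inr a b).map (QuotientGroup.mk' (amalgam hK₁ hK₂ θ)))
  have hS (x) : π (S x) = QuotientGroup.mk' (amalgam hK₁ hK₂ θ) x := by
    change π (s₁ x.1 * s₂ x.2) = _
    rw [map_mul, h₁, h₂, ← map_mul, Prod.mk_mul_mk, one_mul, mul_one]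
  refine ⟨QuotientGroup.lift _ S ?_, QuotientGroup.monoidHom_ext _ (MonoidHom.ext hS)⟩
  rintro _ ⟨a, b, hab, rfl⟩
  rcases hK a b hab with h | ⟨⟨u, x, hux⟩, v, y, hvy⟩
  · exact h
  -- Here `(a, b)` is the commutator of `(u, v)` and `(x, y)`. It dies in the central product, so
  -- the images of these two under `S` commute and `S (a, b) = 1`.
  · have hmul : ((u, v) : G₁ × G₂) * (x, y) = ((a : G₁), (b : G₂)) * ((x, y) * (u, v)) :=
      Prod.ext hux hvy
    have hker : QuotientGroup.mk' (amalgam hK₁ hK₂ θ) ((a : G₁), (b : G₂)) = 1 :=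
      (QuotientGroup.eq_one_iff _).mpr ⟨a, b, hab, rfl⟩
    have hc : Commute (S (u, v)) (S (x, y)) := hcomm _ _ (by
      rw [hS, hS, commute_iff_eq, ← map_mul, ← map_mul, hmul, map_mul, hker, one_mul])
    have := congrArg S hmul
    rw [map_mul, map_mul, map_mul, hc.eq] at this
    exact right_eq_mul.mp this

end CentralProduct

theorem corollary3p2 (p : ℕ) [Fact p.Prime] (k n : ℕ) (hk : 2 ≤ k) (hn : 2 ≤ n)
    (G₁ G₂ : Type) [Group G₁] [Group G₂]
    (e₁ : G₁ ≃* unitriangularGroup k (ZMod p)) (e₂ : G₂ ≃* unitriangularGroup n (ZMod p))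
    (K₁ : Subgroup G₁) (K₂ : Subgroup G₂)
    (hK₁ : K₁ ≤ Subgroup.center G₁) (hK₂ : K₂ ≤ Subgroup.center G₂) (θ : K₁ ≃* K₂) :
    bogomolovMultiplier (CentralProduct hK₁ hK₂ θ) = ⊥ := by
  refine bogomolovMultiplier_eq_bot_of_splits fun E _ π hπ hdiv hcomm => ?_
  let q := QuotientGroup.mk' (amalgam hK₁ hK₂ θ)
  have hlift {H : Type} [Group H] {m : ℕ} (e : H ≃* unitriangularGroup m (ZMod p))
      (φ : H →* CentralProduct hK₁ hK₂ θ) : ∃ s : H →* E, π.comp s = φ := by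
    obtain ⟨s, hs⟩ := unitriangularGroup.exists_lift π hπ
      (hdiv p (Fact.out : p.Prime).ne_zero) hcomm (φ.comp e.symm.toMonoidHom)
    refine ⟨s.comp e.toMonoidHom, MonoidHom.ext fun h => ?_⟩
    have := DFunLike.congr_fun hs (e h)
    simpa using this
  obtain ⟨s₁, h₁⟩ := hlift e₁ (q.comp (MonoidHom.inl G₁ G₂))
  obtain ⟨s₂, h₂⟩ := hlift e₂ (q.comp (MonoidHom.inr G₁ G₂))
  have hq (a : K₁) : q ((a : G₁), 1) = q (1, (θ a : G₂)) := by
    refine (QuotientGroup.eq (s := amalgam hK₁ hK₂ θ)).mpr ⟨a⁻¹, θ a, map_inv θ a, ?_⟩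
    exact Prod.ext (mul_one _) (by simp)
  have hbot (hK : K₁ = ⊥) : ∃ s : CentralProduct hK₁ hK₂ θ →* E, π.comp s = MonoidHom.id _ := by
    refine CentralProduct.exists_section hcomm h₁ h₂ fun a b hab => Or.inl ?_
    have ha : a = 1 := Subtype.ext ((Subgroup.mem_bot).mp (hK ▸ a.2))
    have hb : b = 1 := by rw [← inv_inj, ← hab, ha, map_one, inv_one]
    rw [ha, hb, Subgroup.coe_one, Subgroup.coe_one, map_one, map_one, one_mul]
  rcases unitriangularGroup.subgroup_center_cases hk e₁ hK₁ with hK | rfl | hc₁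
  · exact hbot hK
  -- All of `G₁` is identified with a subgroup of `G₂`. The lift `s₁` need not agree with `s₂`
  -- there, so it is discarded in favour of the restriction of `s₂`.
  · let ψ : G₁ →* G₂ := (K₂.subtype.comp θ.toMonoidHom).comp Subgroup.topEquiv.symm.toMonoidHom
    have hψ (a : (⊤ : Subgroup G₁)) : ψ a = θ a := rfl
    refine CentralProduct.exists_section (s₁ := s₂.comp ψ) hcomm ?_ h₂ fun a b hab => Or.inl ?_
    · rw [← MonoidHom.comp_assoc, h₂]
      exact MonoidHom.ext fun g => (hq ⟨g, Subgroup.mem_top g⟩).symm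
    · rw [MonoidHom.comp_apply, hψ, hab, Subgroup.coe_inv, map_inv, inv_mul_cancel]
  · rcases unitriangularGroup.subgroup_center_cases hn e₂ hK₂ with rfl | rfl | hc₂
    · refine hbot ((Subgroup.eq_bot_iff_forall _).mpr fun a ha => ?_)
      have : θ ⟨a, ha⟩ = 1 := Subsingleton.elim _ _
      exact congrArg Subtype.val ((map_eq_one_iff θ θ.injective).mp this)
    · let ψ : G₂ →* G₁ :=
        (K₁.subtype.comp θ.symm.toMonoidHom).comp Subgroup.topEquiv.symm.toMonoidHom
      have hψ (b : (⊤ : Subgroup G₂)) : ψ b = θ.symm b := rfl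
      refine CentralProduct.exists_section (s₂ := s₁.comp ψ) hcomm h₁ ?_ fun a b hab => Or.inl ?_
      · rw [← MonoidHom.comp_assoc, h₁]
        refine MonoidHom.ext fun g => (hq (θ.symm ⟨g, Subgroup.mem_top g⟩)).trans ?_
        rw [MulEquiv.apply_symm_apply]
        rfl
      · rw [MonoidHom.comp_apply, hψ, ← inv_inv b, ← hab, map_inv, MulEquiv.symm_apply_apply,
          Subgroup.coe_inv, map_inv, mul_inv_cancel]
    · exact CentralProduct.exists_section hcomm h₁ h₂ fun a b _ => Or.inr ⟨hc₁ a a.2, hc₂ b b.2⟩
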